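/- For $n\ge 1$ and $\beta\in\mathbb R$, let $X_1,\dots,X_n$ be i.i.d. with $\mathbb P(X_k=1)=\mathbb P(X_k=-1)=\tfrac12$ and $S_n=X_1+\dots+X_n$. The Curie–Weiss spins $(X_1^{(\beta)},\dots,X_n^{(\beta)})$ are random variables whose law is that of $(X_1,\dots,X_n)$ biased by the density $e^{\frac{\beta}{2n}S_n^2}\big/\mathbb E\big[e^{\frac{\beta}{2n}S_n^2}\big]$, and $M_n^{(\beta)}=\sum_{k=1}^n X_k^{(\beta)}$ is the unnormalised magnetisation. **Theorem 3.3.** Let $\gamma\in\mathbb R$, $\gamma\ne 0$, let $\beta_n=1-\gamma/\sqrt n$, and let $F_\gamma$ be a random variable with law $$\mathbb P(F_\gamma\in dx)=\frac{1}{Z_\gamma}\,e^{-\frac{x^4}{12}-\gamma\frac{x^2}{2}}\,dx,\qquad Z_\gamma=\int_{\mathbb R}e^{-\frac{x^4}{12}-\gamma\frac{x^2}{2}}\,dx .$$ Then there exist a constant $C>0$ and a sequence $(r_n)_{n\ge1}$ of real numbers with $r_n=O(n^{-3/4})$ as $n\to\infty$, both depending only on $\gamma$, such that for every $n\ge 1$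 and every $h\in\mathcal C^1(\mathbb R,\mathbb R)$ with $\|h\|_\infty<\infty$ and $\|h'\|_\infty<\infty$, $$\left|\mathbb E\left[h\!\left(\frac{M_n^{(\beta_n)}}{n^{3/4}}\right)\right]-\mathbb E\left[h(F_\gamma)\right]\right|\le\left(\frac{C}{\sqrt n}+r_n\right)\big(\|h\|_\infty+\|h'\|_\infty\big).$$ -/

import Mathlib

open MeasureTheory Filter Asymptotics

noncomputable section

namespace CurieWeiss

/-- The symmetric Bernoulli law on `{-1, 1}`: `(δ₁ + δ₋₁) / 2`. -/
def signLaw : Measure ℝ :=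
  (2⁻¹ : ENNReal) • (Measure.dirac (1 : ℝ) + Measure.dirac (-1 : ℝ))

/-- The law of `n` i.i.d. symmetric `±1` spins. -/
def freeSpinLaw (n : ℕ) : Measure (Fin n → ℝ) :=
  Measure.pi fun _ => signLaw

/-- The unnormalised magnetisation of a spin configuration: the sum of the spins. -/
def magnetisation {n : ℕ} (x : Fin n → ℝ) : ℝ :=
  ∑ k, x k

/-- The Curie-Weiss law of `n` spins at inverse temperature `β`, without external field: the law of
the i.i.d. spins biased by `exp (β S_n ^ 2 / (2 n)) / E[exp (β S_n ^ 2 / (2 n))]`.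
(`μ.tilted f` is the measure with density `exp f / ∫ exp f ∂μ` with respect to `μ`.) -/
def spinLaw (n : ℕ) (β : ℝ) : Measure (Fin n → ℝ) :=
  (freeSpinLaw n).tilted fun x => β / (2 * (n : ℝ)) * magnetisation x ^ 2

/-- The law of `F_γ`: the measure on `ℝ` with Lebesgue density
`exp (-x ^ 4 / 12 - γ x ^ 2 / 2) / ∫ exp (-y ^ 4 / 12 - γ y ^ 2 / 2) dy`. -/
def limitLaw (γ : ℝ) : Measure ℝ :=
  (volume : Measure ℝ).tilted fun x => -(x ^ 4 / 12) - γ * (x ^ 2 / 2)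

/-- The supremum norm of a real function (meaningful for bounded functions). -/
def supNorm (f : ℝ → ℝ) : ℝ :=
  ⨆ x, |f x|

end CurieWeiss

end

namespace CurieWeiss

/-! ### Elementary calculus -/

/-! The proof is Stein's method. `limitLaw γ` is characterised by the operator `g' - drift γ * g`.
Given `h`, the equation `g' - drift γ * g = h - ∫ h` has a solution such that `|g| (1 + |x| ^ 3)`,
`|g'|` and `|g''|` are at most a constant times `‖h‖ + ‖h'‖` (`exists_stein_solution`).

On the spin side, reversing one spin gives the exact identity `E[(X_i - tanh (β (M - X_i) / n)) f (M
- X_i)] = 0` (`integral_spin_sub_tanh`). Put `ε = n ^ (-1/4)` and `W = ε ^ 3 M`, apply the identity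
with `f y = g (ε ^ 3 y)`, sum over `i`, multiply by `ε` and Taylor expand. The linear part of `tanh`
almost cancels, leaving `γ W`; its cubic part gives `W ^ 3 / 3`; and `∑ x_i ^ 2 = n` produces `g'
W`. So `drift γ W * g W - g' W` has expectation zero up to `O(ε ^ 2 (1 + E[W ^ 2]))`
(`abs_spin_expansion_le`), and by the Stein equation it equals `∫ h - h W`.

The same identity with `f y = y` bounds `E[W ^ 2]` uniformly in `n`
(`integral_sq_magnetisation_le`). Since `ε ^ 2 = 1 / √n`, this is the claimed rate for large `n`;
for the remaining `n` the trivial bound `2 ‖h‖` suffices. -/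

lemma hasDerivAt_tanh (x : ℝ) : HasDerivAt Real.tanh (1 - Real.tanh x ^ 2) x := by
  have h := (Real.hasDerivAt_sinh x).div (Real.hasDerivAt_cosh x) (Real.cosh_pos x).ne'
  have e : (Real.sinh / Real.cosh : ℝ → ℝ) = Real.tanh := by
    funext y; simp [Real.tanh_eq_sinh_div_cosh]
  rw [e] at h
  refine h.congr_deriv ?_
  rw [Real.tanh_eq_sinh_div_cosh]
  have := (Real.cosh_pos x).ne'
  field_simp

lemma continuous_tanh : Continuous Real.tanh :=
  continuous_iff_continuousAt.2 fun x => (hasDerivAt_tanh x).continuousAt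

/-- Drives the Taylor bounds on `tanh` below: each bound, inserted into the derivative `1 - tanh ^
2`, yields the next one. -/
lemma nonneg_of_hasDerivAt_nonneg {f f' : ℝ → ℝ} (hf : ∀ x, HasDerivAt f (f' x) x)
    (h0 : f 0 = 0) (hf' : ∀ x, 0 ≤ x → 0 ≤ f' x) {x : ℝ} (hx : 0 ≤ x) : 0 ≤ f x := by
  have := monotoneOn_of_hasDerivWithinAt_nonneg (convex_Ici (0 : ℝ))
    (fun y _ => (hf y).continuousAt.continuousWithinAt)
    (fun y _ => (hf y).hasDerivWithinAt) (fun y hy => hf' y (interior_subset hy))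
  simpa [h0] using this (Set.mem_Ici.2 le_rfl) (Set.mem_Ici.2 hx) hx

lemma abs_tanh_le_one (x : ℝ) : |Real.tanh x| ≤ 1 :=
  (abs_lt.2 ⟨Real.neg_one_lt_tanh x, Real.tanh_lt_one x⟩).le

lemma tanh_sq_le_one (x : ℝ) : Real.tanh x ^ 2 ≤ 1 := by
  rw [← sq_abs]; exact pow_le_one₀ (abs_nonneg _) (abs_tanh_le_one x)

lemma tanh_nonneg {x : ℝ} (hx : 0 ≤ x) : 0 ≤ Real.tanh x :=
  nonneg_of_hasDerivAt_nonneg hasDerivAt_tanh Real.tanh_zero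
    (fun y _ => by linarith [tanh_sq_le_one y]) hx

lemma tanh_le_self {x : ℝ} (hx : 0 ≤ x) : Real.tanh x ≤ x := by
  have := nonneg_of_hasDerivAt_nonneg (f := fun y => y - Real.tanh y)
    (fun y => (hasDerivAt_id y).sub (hasDerivAt_tanh y)) (by simp)
    (fun y _ => by nlinarith [sq_nonneg (Real.tanh y)]) hx
  simpa using this

lemma le_tanh {x : ℝ} (hx : 0 ≤ x) : x - x ^ 3 / 3 ≤ Real.tanh x := by
  have := nonneg_of_hasDerivAt_nonneg (f := fun y => Real.tanh y - (y - y ^ 3 / 3))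
    (fun y => (hasDerivAt_tanh y).sub ((hasDerivAt_id y).sub ((hasDerivAt_pow 3 y).div_const 3)))
    (by simp)
    (fun y hy => by
      have := pow_le_pow_left₀ (tanh_nonneg hy) (tanh_le_self hy) 2
      norm_num
      nlinarith) hx
  simpa using this

lemma tanh_le {x : ℝ} (hx : 0 ≤ x) : Real.tanh x ≤ x - x ^ 3 / 3 + 2 * x ^ 5 / 15 := by
  have := nonneg_of_hasDerivAt_nonneg
    (f := fun y => (y - y ^ 3 / 3 + (2 * y ^ 5) / 15) - Real.tanh y)
    (fun y => (((hasDerivAt_id y).sub ((hasDerivAt_pow 3 y).div_const 3)).add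
      (((hasDerivAt_pow 5 y).const_mul 2).div_const 15)).sub (hasDerivAt_tanh y))
    (by simp)
    (fun y hy => by
      have h1 := le_tanh hy
      have h2 := tanh_le_self hy
      have h3 := tanh_nonneg hy
      have h4 : (y - Real.tanh y) * (y + Real.tanh y) ≤ (y ^ 3 / 3) * (2 * y) :=
        mul_le_mul (by linarith) (by linarith) (by linarith) (by positivity)
      norm_num
      nlinarith) hx
  simpa using this

lemma abs_tanh_le (x : ℝ) : |Real.tanh x| ≤ |x| := by
  rcases le_total 0 x with hx | hx
  · rw [abs_of_nonneg hx, abs_of_nonneg (tanh_nonneg hx)]; exact tanh_le_self hx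
  · have hx' : 0 ≤ -x := by linarith
    have h1 := tanh_le_self hx'
    have h2 := tanh_nonneg hx'
    rw [Real.tanh_neg] at h1 h2
    rw [abs_of_nonpos hx, abs_of_nonpos (by linarith)]; exact h1

lemma abs_tanh_sub_le (x : ℝ) : |Real.tanh x - (x - x ^ 3 / 3)| ≤ |x| ^ 5 := by
  have key : ∀ y : ℝ, 0 ≤ y → |Real.tanh y - (y - y ^ 3 / 3)| ≤ y ^ 5 := fun y hy => by
    have h5 : 0 ≤ y ^ 5 := by positivity
    rw [abs_of_nonneg (by linarith [le_tanh hy])]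
    linarith [tanh_le hy]
  rcases le_total 0 x with hx | hx
  · rw [abs_of_nonneg hx]; exact key x hx
  · have := key (-x) (by linarith)
    rw [Real.tanh_neg] at this
    rw [abs_of_nonpos hx, ← abs_neg]
    convert this using 2
    ring

/-- The coefficient is `1/3 - (2/15) (5/4) ^ 2 = 1/8`. This quartic gain is what confines the
magnetisation in the second moment bound. -/
lemma mul_tanh_le {x : ℝ} (hx : |x| ≤ 5 / 4) : x * Real.tanh x ≤ x ^ 2 - x ^ 4 / 8 := by
  have key : ∀ y : ℝ, 0 ≤ y → y ≤ 5 / 4 → y * Real.tanh y ≤ y ^ 2 - y ^ 4 / 8 := fun y hy hy' => by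
    have h1 := mul_le_mul_of_nonneg_left (tanh_le hy) hy
    have h2 : y ^ 2 ≤ 25 / 16 := by nlinarith
    have h3 := mul_le_mul_of_nonneg_left h2 (by positivity : 0 ≤ y ^ 4)
    nlinarith
  rw [abs_le] at hx
  rcases le_total 0 x with h | h
  · exact key x h hx.2
  · have := key (-x) (by linarith) (by linarith)
    rw [Real.tanh_neg] at this
    nlinarith

/-- Second order Taylor expansion of a function with bounded second derivative. -/
lemma abs_taylor_le {f f' f'' : ℝ → ℝ} {B : ℝ} (hf : ∀ x, HasDerivAt f (f' x) x)
    (hf' : ∀ x, HasDerivAt f' (f'' x) x) (hB : ∀ x, |f'' x| ≤ B) (x t : ℝ) :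
    |f (x + t) - f x - t * f' x| ≤ B * t ^ 2 := by
  have h1 : ∀ s, |f' (x + s) - f' x| ≤ B * |s| := fun s => by
    have := convex_univ.norm_image_sub_le_of_norm_hasDerivWithin_le
      (fun y _ => (hf' y).hasDerivWithinAt) (fun y _ => hB y) (Set.mem_univ x)
      (Set.mem_univ (x + s))
    simpa using this
  have hB0 : 0 ≤ B := (abs_nonneg _).trans (hB 0)
  have h2 := (convex_uIcc (0 : ℝ) t).norm_image_sub_le_of_norm_hasDerivWithin_le
    (f := fun s => f (x + s) - s * f' x) (f' := fun s => f' (x + s) - f' x) (C := B * |t|)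
    (x := 0) (y := t)
    (fun s _ => by
      have := ((hf (x + s)).comp_const_add x s).fun_sub ((hasDerivAt_id s).mul_const (f' x))
      simpa using this.hasDerivWithinAt)
    (fun s hs => (h1 s).trans (mul_le_mul_of_nonneg_left
      (by simpa using Set.abs_sub_left_of_mem_uIcc hs) hB0)) Set.left_mem_uIcc Set.right_mem_uIcc
  have h3 : B * |t| * ‖t - 0‖ = B * t ^ 2 := by
    rw [sub_zero, Real.norm_eq_abs, mul_assoc, ← sq, sq_abs]
  rw [h3, Real.norm_eq_abs] at h2
  convert h2 using 2
  simp; ring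

/-! ### The spin law -/

instance isProbabilityMeasure_signLaw : IsProbabilityMeasure signLaw := ⟨by
  simp [signLaw, ENNReal.inv_two_add_inv_two]⟩

instance isProbabilityMeasure_freeSpinLaw (n : ℕ) : IsProbabilityMeasure (freeSpinLaw n) := by
  unfold freeSpinLaw; infer_instance

lemma ae_signLaw : ∀ᵐ y ∂signLaw, y = 1 ∨ y = -1 := by
  have hs : MeasurableSet {y : ℝ | y = 1 ∨ y = -1} := (Set.toFinite ({1, -1} : Set ℝ)).measurableSet
  refine Measure.ae_smul_measure ?_ _
  rw [ae_add_measure_iff, ae_dirac_iff hs, ae_dirac_iff hs]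
  simp

lemma measurePreserving_neg_signLaw : MeasurePreserving (fun y : ℝ => -y) signLaw signLaw := by
  refine ⟨measurable_neg, ?_⟩
  unfold signLaw
  have h : ∀ y : ℝ, (Measure.dirac y).map (fun y : ℝ => -y) = Measure.dirac (-y) := fun y =>
    Measure.map_dirac' measurable_neg y
  rw [Measure.map_smul, Measure.map_add _ _ measurable_neg, h, h, neg_neg, add_comm]

lemma ae_freeSpinLaw (n : ℕ) : ∀ᵐ x ∂freeSpinLaw n, ∀ i, x i = 1 ∨ x i = -1 := by
  rw [ae_all_iff]
  exact fun i => (measurePreserving_eval (fun _ : Fin n => signLaw) i).quasiMeasurePreserving.ae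
    ae_signLaw

/-- The configuration with the spin at `i` reversed. -/
def flip {n : ℕ} (i : Fin n) (x : Fin n → ℝ) : Fin n → ℝ := Function.update x i (-x i)

lemma measurePreserving_flip {n : ℕ} (i : Fin n) :
    MeasurePreserving (flip i) (freeSpinLaw n) (freeSpinLaw n) := by
  have h := measurePreserving_pi (fun _ : Fin n => signLaw) (fun _ : Fin n => signLaw)
    (f := fun j => if j = i then fun y : ℝ => -y else id) (fun j => by
      by_cases hj : j = i
      · simpa [hj] using measurePreserving_neg_signLaw
      · simpa [hj] using MeasurePreserving.id signLaw)
  have e : flip i = fun (x : Fin n → ℝ) j => (if j = i then fun y : ℝ => -y else id) (x j) := by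
    funext x j
    by_cases hj : j = i
    · subst hj; simp [flip]
    · simp [flip, hj]
  rw [e]
  exact h

lemma flip_self {n : ℕ} (i : Fin n) (x : Fin n → ℝ) : flip i x i = -x i := by simp [flip]

lemma magnetisation_flip {n : ℕ} (i : Fin n) (x : Fin n → ℝ) :
    magnetisation (flip i x) = magnetisation x - 2 * x i := by
  have h1 := Finset.sum_update_of_mem (Finset.mem_univ i) x (-x i)
  have h2 := Finset.sum_update_of_mem (Finset.mem_univ i) x (x i)
  rw [Function.update_eq_self] at h2
  simp only [magnetisation, flip] at *
  rw [h1, h2]; ring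

lemma continuous_magnetisation (n : ℕ) : Continuous (magnetisation : (Fin n → ℝ) → ℝ) := by
  unfold magnetisation; fun_prop

lemma integrable_of_ae_spin {n : ℕ} {μ : Measure (Fin n → ℝ)} [IsFiniteMeasure μ]
    (hμ : ∀ᵐ x ∂μ, ∀ i, x i = 1 ∨ x i = -1) {F : (Fin n → ℝ) → ℝ} (hF : Continuous F) :
    Integrable F μ := by
  have hc : IsCompact (Set.univ.pi fun _ : Fin n => Set.Icc (-1 : ℝ) 1) :=
    isCompact_univ_pi fun _ => isCompact_Icc
  obtain ⟨B, hB⟩ := hc.exists_bound_of_continuousOn hF.continuousOn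
  refine Integrable.of_bound hF.aestronglyMeasurable B ?_
  filter_upwards [hμ] with x hx
  refine hB x fun i _ => ?_
  rcases hx i with h | h <;> rw [h] <;> norm_num

lemma continuous_energy (n : ℕ) (β : ℝ) :
    Continuous fun x : Fin n → ℝ => β / (2 * (n : ℝ)) * magnetisation x ^ 2 := by
  have := continuous_magnetisation n
  fun_prop

instance isProbabilityMeasure_spinLaw (n : ℕ) (β : ℝ) : IsProbabilityMeasure (spinLaw n β) :=
  isProbabilityMeasure_tilted
    (integrable_of_ae_spin (ae_freeSpinLaw n) (Real.continuous_exp.comp (continuous_energy n β)))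

lemma ae_spinLaw (n : ℕ) (β : ℝ) : ∀ᵐ x ∂spinLaw n β, ∀ i, x i = 1 ∨ x i = -1 :=
  (tilted_absolutelyContinuous _ _).ae_le (ae_freeSpinLaw n)

lemma integrable_spinLaw {n : ℕ} (β : ℝ) {F : (Fin n → ℝ) → ℝ} (hF : Continuous F) :
    Integrable F (spinLaw n β) :=
  integrable_of_ae_spin (ae_spinLaw n β) hF

/-- Detailed balance for one spin in a field `a`, where the values `1` and `-1` have weights `exp a`
and `exp (-a)`. -/
lemma exp_mul_one_sub_tanh (a : ℝ) :
    Real.exp a * (1 - Real.tanh a) = Real.exp (-a) * (1 + Real.tanh a) := by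
  rw [Real.tanh_eq_sinh_div_cosh]
  have h := (Real.cosh_pos a).ne'
  field_simp
  rw [← Real.cosh_add_sinh, ← Real.cosh_sub_sinh]
  ring

/-- Given the other spins, the spin at `i` has mean `tanh (β (M - x i) / n)`. -/
lemma integral_spin_sub_tanh {n : ℕ} (β : ℝ) (i : Fin n) {f : ℝ → ℝ} (hf : Continuous f) :
    ∫ x, (x i - Real.tanh (β / n * (magnetisation x - x i))) * f (magnetisation x - x i)
      ∂spinLaw n β = 0 := by
  have hn : (n : ℝ) ≠ 0 := by exact_mod_cast (Fin.pos i).ne'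
  unfold spinLaw
  rw [integral_tilted]
  simp_rw [smul_eq_mul, div_mul_eq_mul_div]
  rw [integral_div]
  set F : (Fin n → ℝ) → ℝ := fun x => Real.exp (β * magnetisation x ^ 2 / (2 * n)) *
    ((x i - Real.tanh (β * (magnetisation x - x i) / n)) * f (magnetisation x - x i)) with hF
  have hFc : Continuous F := by
    have := continuous_magnetisation n
    have := continuous_tanh
    fun_prop
  suffices h : ∫ x, F x ∂freeSpinLaw n = 0 by rw [h, zero_div]
  have h1 : ∫ x, F (flip i x) ∂freeSpinLaw n = ∫ x, F x ∂freeSpinLaw n := by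
    have hm := measurePreserving_flip i
    conv_rhs => rw [← hm.map_eq]
    rw [integral_map hm.measurable.aemeasurable hFc.aestronglyMeasurable]
  -- The flip fixes `M - x i` and, by detailed balance, changes the sign of the weighted integrand.
  -- The integral therefore equals its own negative.
  have h2 : ∫ x, F (flip i x) ∂freeSpinLaw n = ∫ x, -F x ∂freeSpinLaw n := by
    refine integral_congr_ae ?_
    filter_upwards [ae_freeSpinLaw n] with x hx
    simp only [hF, magnetisation_flip, flip_self]
    set s := magnetisation x - x i with hs
    have hM : magnetisation x = s + x i := by ring
    have key := exp_mul_one_sub_tanh (β * s / n)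
    have e1 : Real.exp (β * (s + 1) ^ 2 / (2 * n)) =
        Real.exp (β * (s ^ 2 + 1) / (2 * n)) * Real.exp (β * s / n) := by
      rw [← Real.exp_add]; congr 1; field_simp; ring
    have e2 : Real.exp (β * (s + -1) ^ 2 / (2 * n)) =
        Real.exp (β * (s ^ 2 + 1) / (2 * n)) * Real.exp (-(β * s / n)) := by
      rw [← Real.exp_add]; congr 1; field_simp; ring
    have e3 : magnetisation x - 2 * x i - -x i = s := by ring
    have e4 : magnetisation x - 2 * x i = s + -x i := by ring
    rw [e3, e4, hM]
    rcases hx i with h | h <;> rw [h]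
    · rw [e1, e2]; linear_combination (Real.exp (β * (s ^ 2 + 1) / (2 * n)) * f s) * key
    · rw [neg_neg, e1, e2]
      linear_combination (Real.exp (β * (s ^ 2 + 1) / (2 * n)) * f s) * key
  rw [h1, integral_neg] at h2
  linarith

/-! ### The Stein equation of the limit law -/

/-- The unnormalised density of the limit law. -/
noncomputable def limitDensity (γ x : ℝ) : ℝ := Real.exp (-(x ^ 4 / 12) - γ * (x ^ 2 / 2))

/-- Minus the logarithmic derivative of `limitDensity`. -/
noncomputable def drift (γ x : ℝ) : ℝ := x ^ 3 / 3 + γ * x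

lemma limitDensity_pos (γ x : ℝ) : 0 < limitDensity γ x := Real.exp_pos _

lemma limitDensity_neg (γ x : ℝ) : limitDensity γ (-x) = limitDensity γ x := by
  unfold limitDensity; congr 1; ring

lemma drift_neg (γ x : ℝ) : drift γ (-x) = -drift γ x := by
  unfold drift; ring

lemma hasDerivAt_limitDensity (γ x : ℝ) :
    HasDerivAt (limitDensity γ) (-(drift γ x * limitDensity γ x)) x := by
  have h : HasDerivAt (fun y : ℝ => -(y ^ 4 / 12) - γ * (y ^ 2 / 2)) (-drift γ x) x := by
    have := ((hasDerivAt_pow 4 x).div_const 12).fun_neg.fun_sub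
      (((hasDerivAt_pow 2 x).div_const 2).const_mul γ)
    refine this.congr_deriv ?_
    unfold drift; norm_num; ring
  refine h.exp.congr_deriv ?_
  unfold limitDensity; ring

lemma hasDerivAt_drift (γ x : ℝ) : HasDerivAt (drift γ) (x ^ 2 + γ) x := by
  have := ((hasDerivAt_pow 3 x).div_const 3).fun_add ((hasDerivAt_id x).const_mul γ)
  refine this.congr_deriv ?_
  norm_num

lemma continuous_limitDensity (γ : ℝ) : Continuous (limitDensity γ) := by
  unfold limitDensity; fun_prop

lemma limitDensity_le (γ x : ℝ) :
    limitDensity γ x ≤ Real.exp (3 * (γ / 2 - 1) ^ 2) * Real.exp (-1 * x ^ 2) := by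
  unfold limitDensity
  rw [← Real.exp_add, Real.exp_le_exp]
  nlinarith [sq_nonneg (x ^ 2 + 6 * (γ / 2 - 1))]

lemma integrable_limitDensity (γ : ℝ) : Integrable (limitDensity γ) := by
  refine Integrable.mono' ((integrable_exp_neg_mul_sq one_pos).const_mul
    (Real.exp (3 * (γ / 2 - 1) ^ 2)))
    (continuous_limitDensity γ).aestronglyMeasurable (Eventually.of_forall fun x => ?_)
  rw [Real.norm_of_nonneg (limitDensity_pos γ x).le]
  exact limitDensity_le γ x

lemma tendsto_limitDensity_atTop (γ : ℝ) : Tendsto (limitDensity γ) atTop (nhds 0) := by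
  refine squeeze_zero (fun x => (limitDensity_pos γ x).le) (limitDensity_le γ) ?_
  rw [← mul_zero (Real.exp (3 * (γ / 2 - 1) ^ 2))]
  refine Tendsto.const_mul _ (Real.tendsto_exp_atBot.comp ?_)
  exact (tendsto_pow_atTop two_ne_zero).const_mul_atTop_of_neg (by norm_num)

lemma tendsto_limitDensity_atBot (γ : ℝ) : Tendsto (limitDensity γ) atBot (nhds 0) := by
  refine ((tendsto_limitDensity_atTop γ).comp tendsto_neg_atBot_atTop).congr fun x => ?_
  exact limitDensity_neg γ x

lemma hasDerivAt_limitDensity_mul {γ : ℝ} {u k : ℝ → ℝ} {x : ℝ}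
    (hu : HasDerivAt u (drift γ x * u x + k x) x) :
    HasDerivAt (fun y => limitDensity γ y * u y) (limitDensity γ x * k x) x :=
  ((hasDerivAt_limitDensity γ x).fun_mul hu).congr_deriv (by ring)

/-- A barrier argument. Beyond `R` the drift at `y ≥ x` is at least `x ^ 3 / 6`, so with `c = 6 K /
x ^ 3` the function `limitDensity * (c + u)` decreases on `[x, ∞)`. Its limit is `0`, hence it is
nonnegative at `x`. -/
lemma neg_le_mul_cube_of_stein {γ R K : ℝ} (hR : 1 ≤ R) (hγR : 6 * |γ| ≤ R ^ 2) {u k : ℝ → ℝ}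
    (hu : ∀ x, HasDerivAt u (drift γ x * u x + k x) x) (hk : ∀ x, |k x| ≤ K)
    (ht : Tendsto (fun x => limitDensity γ x * u x) atTop (nhds 0)) {x : ℝ} (hx : R ≤ x) :
    -(6 * K) ≤ u x * x ^ 3 := by
  have hx0 : 0 < x := by linarith
  have hK : 0 ≤ K := (abs_nonneg _).trans (hk 0)
  set c := 6 * K / x ^ 3 with hc
  have hc0 : 0 ≤ c := by positivity
  have hanti : AntitoneOn (fun y => c * limitDensity γ y + limitDensity γ y * u y) (Set.Ici x) := by
    refine antitoneOn_of_hasDerivWithinAt_nonpos (convex_Ici x)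
      (f' := fun y => c * -(drift γ y * limitDensity γ y) + limitDensity γ y * k y) ?_ ?_ ?_
    · intro y _
      exact (((hasDerivAt_limitDensity γ y).const_mul c).fun_add
        (hasDerivAt_limitDensity_mul (hu y))).continuousAt.continuousWithinAt
    · intro y _
      exact (((hasDerivAt_limitDensity γ y).const_mul c).fun_add
        (hasDerivAt_limitDensity_mul (hu y))).hasDerivWithinAt
    · intro y hy
      have hy' : x ≤ y := interior_subset hy
      have h1 : x ^ 3 / 6 ≤ drift γ y := by
        have h2 : x ^ 3 ≤ y ^ 3 := pow_le_pow_left₀ hx0.le hy' 3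
        have h3 : 6 * |γ| ≤ y ^ 2 := hγR.trans (pow_le_pow_left₀ (by linarith) (hx.trans hy') 2)
        have h4 := neg_abs_le γ
        have h5 : 0 ≤ (y ^ 2 / 6 + γ) * y := mul_nonneg (by linarith) (by linarith)
        unfold drift
        nlinarith
      have h2 : K ≤ c * drift γ y := by
        have := mul_le_mul_of_nonneg_left h1 hc0
        have e : c * (x ^ 3 / 6) = K := by rw [hc]; field_simp
        linarith
      have h3 := (le_abs_self _).trans (hk y)
      have := mul_nonneg (limitDensity_pos γ y).le (by linarith : 0 ≤ c * drift γ y - k y)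
      linarith
  have hlim : Tendsto (fun y => c * limitDensity γ y + limitDensity γ y * u y) atTop (nhds 0) := by
    simpa using ((tendsto_limitDensity_atTop γ).const_mul c).add ht
  have h0 : 0 ≤ c * limitDensity γ x + limitDensity γ x * u x :=
    le_of_tendsto hlim <| (eventually_ge_atTop x).mono fun y hy =>
      hanti (Set.mem_Ici.2 le_rfl) (Set.mem_Ici.2 hy) hy
  have h1 : 0 ≤ c + u x := by
    by_contra hneg
    nlinarith [limitDensity_pos γ x]
  have h2 := mul_nonneg h1 (pow_pos hx0 3).le
  have e : c * x ^ 3 = 6 * K := by rw [hc]; field_simp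
  linarith

lemma abs_mul_cube_le_of_stein {γ R K : ℝ} (hR : 1 ≤ R) (hγR : 6 * |γ| ≤ R ^ 2) {u k : ℝ → ℝ}
    (hu : ∀ x, HasDerivAt u (drift γ x * u x + k x) x) (hk : ∀ x, |k x| ≤ K)
    (ht : Tendsto (fun x => limitDensity γ x * u x) atTop (nhds 0)) {x : ℝ} (hx : R ≤ x) :
    |u x| * x ^ 3 ≤ 6 * K := by
  have hx0 : 0 < x := by linarith
  have h1 := neg_le_mul_cube_of_stein hR hγR hu hk ht hx
  have h2 := neg_le_mul_cube_of_stein (u := fun y => -u y) (k := fun y => -k y) hR hγR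
    (fun y => (hu y).fun_neg.congr_deriv (by ring)) (fun y => by rw [abs_neg]; exact hk y)
    (by simpa using ht.neg) hx
  rw [← abs_of_pos (pow_pos hx0 3), ← abs_mul, abs_le]
  constructor <;> linarith

/-- Solutions of the Stein equation with bounded right-hand side decay cubically. -/
lemma exists_stein_bound (γ : ℝ) : ∃ C : ℝ, 0 < C ∧ ∀ (K : ℝ) (u k : ℝ → ℝ),
    (∀ x, HasDerivAt u (drift γ x * u x + k x) x) → (∀ x, |k x| ≤ K) →
    Tendsto (fun x => limitDensity γ x * u x) atTop (nhds 0) →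
    Tendsto (fun x => limitDensity γ x * u x) atBot (nhds 0) →
    ∀ x, |u x| * (1 + |x| ^ 3) ≤ C * K := by
  set R : ℝ := 6 * |γ| + 1 with hRdef
  set L : ℝ := R ^ 4 / 12 + |γ| * (R ^ 2 / 2) with hL
  have hR : 1 ≤ R := by have := abs_nonneg γ; linarith
  have hγR : 6 * |γ| ≤ R ^ 2 := by nlinarith
  -- On `[-R, R]` the density lies between `exp (-L)` and `exp L`; the mean value inequality for
  -- density times `u`, started from `|u R| ≤ 6 K` over a distance at most `2 R`, gives the first
  -- summand. The `12` covers the tails, where `1 ≤ |x| ^ 3`.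
  refine ⟨Real.exp L * (Real.exp L * (6 + 2 * R)) * (1 + R ^ 3) + 12, by positivity,
    fun K u k hu hk htop hbot x => ?_⟩
  have hK : 0 ≤ K := (abs_nonneg _).trans (hk 0)
  have hpos : ∀ y, R ≤ y → |u y| * y ^ 3 ≤ 6 * K := fun y hy =>
    abs_mul_cube_le_of_stein hR hγR hu hk htop hy
  have hneg : ∀ y, R ≤ y → |u (-y)| * y ^ 3 ≤ 6 * K := fun y hy => by
    refine abs_mul_cube_le_of_stein (u := fun y => u (-y)) (k := fun y => -k (-y)) hR hγR
      (fun y => ?_) (fun y => by rw [abs_neg]; exact hk _) ?_ hy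
    · refine ((hu (-y)).comp y (hasDerivAt_neg y)).congr_deriv ?_
      rw [drift_neg]; ring
    · refine (hbot.comp tendsto_neg_atTop_atBot).congr fun y => ?_
      simp [limitDensity_neg]
  rcases le_total |x| R with hx | hx
  · have hle : ∀ y, |y| ≤ R → |-(y ^ 4 / 12) - γ * (y ^ 2 / 2)| ≤ L := fun y hy => by
      have h2 : y ^ 2 ≤ R ^ 2 := by rw [← sq_abs]; exact pow_le_pow_left₀ (abs_nonneg _) hy 2
      have h4 : y ^ 4 ≤ R ^ 4 := by
        have := pow_le_pow_left₀ (sq_nonneg y) h2 2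
        nlinarith
      refine (abs_sub _ _).trans ?_
      rw [abs_neg, abs_mul, abs_of_nonneg (by positivity : 0 ≤ y ^ 4 / 12),
        abs_of_nonneg (by positivity : 0 ≤ y ^ 2 / 2), hL]
      gcongr
    have hlow : ∀ y, |y| ≤ R → Real.exp (-L) ≤ limitDensity γ y := fun y hy =>
      Real.exp_le_exp.2 (abs_le.1 (hle y hy)).1
    have hup : ∀ y, |y| ≤ R → limitDensity γ y ≤ Real.exp L := fun y hy =>
      Real.exp_le_exp.2 (abs_le.1 (hle y hy)).2
    have hRR : |R| ≤ R := (abs_of_nonneg (by linarith)).le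
    have hmv := (convex_Icc (-R) R).norm_image_sub_le_of_norm_hasDerivWithin_le
      (f := fun y => limitDensity γ y * u y) (C := Real.exp L * K)
      (fun y _ => (hasDerivAt_limitDensity_mul (hu y)).hasDerivWithinAt)
      (fun y hy => by
        rw [norm_mul, Real.norm_of_nonneg (limitDensity_pos γ y).le]
        exact mul_le_mul (hup y (abs_le.2 hy)) (hk y) (abs_nonneg _) (Real.exp_pos _).le)
      (abs_le.1 hRR) (abs_le.1 hx)
    have hdist : ‖x - R‖ ≤ 2 * R := by
      rw [Real.norm_eq_abs, abs_le]; rw [abs_le] at hx; constructor <;> linarith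
    have huR : |u R| ≤ 6 * K := by
      have h1 := hpos R le_rfl
      have h2 : 1 ≤ R ^ 3 := one_le_pow₀ hR
      nlinarith [abs_nonneg (u R)]
    have h1 : |limitDensity γ x * u x| ≤ Real.exp L * (6 + 2 * R) * K := by
      have h2 : |limitDensity γ R * u R| ≤ Real.exp L * (6 * K) := by
        rw [abs_mul, abs_of_pos (limitDensity_pos γ R)]
        exact mul_le_mul (hup R hRR) huR (abs_nonneg _) (Real.exp_pos _).le
      have h3 := hmv.trans (mul_le_mul_of_nonneg_left hdist (by positivity))
      have h4 := abs_sub_abs_le_abs_sub (limitDensity γ x * u x) (limitDensity γ R * u R)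
      rw [Real.norm_eq_abs] at h3
      linarith
    have h2 : |u x| ≤ Real.exp L * (Real.exp L * (6 + 2 * R)) * K := by
      rw [abs_mul, abs_of_pos (limitDensity_pos γ x)] at h1
      have h3 := (mul_le_mul_of_nonneg_right (hlow x hx) (abs_nonneg (u x))).trans h1
      calc |u x| = Real.exp L * (Real.exp (-L) * |u x|) := by
            rw [← mul_assoc, ← Real.exp_add]; simp
        _ ≤ Real.exp L * (Real.exp L * (6 + 2 * R) * K) := by gcongr
        _ = _ := by ring
    calc |u x| * (1 + |x| ^ 3)
        ≤ Real.exp L * (Real.exp L * (6 + 2 * R)) * K * (1 + R ^ 3) := by gcongr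
      _ ≤ _ := by nlinarith
  · have h1 : |u x| * |x| ^ 3 ≤ 6 * K := by
      rcases abs_cases x with ⟨h, _⟩ | ⟨h, _⟩
      · rw [h] at hx ⊢; exact hpos x hx
      · rw [h] at hx ⊢; simpa using hneg (-x) hx
    have h2 : 1 ≤ |x| ^ 3 := one_le_pow₀ (hR.trans hx)
    have h3 : |u x| ≤ |u x| * |x| ^ 3 := le_mul_of_one_le_right (abs_nonneg _) h2
    have h4 : 0 ≤ Real.exp L * (Real.exp L * (6 + 2 * R)) * (1 + R ^ 3) * K := by positivity
    linarith

instance isProbabilityMeasure_limitLaw (γ : ℝ) : IsProbabilityMeasure (limitLaw γ) :=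
  isProbabilityMeasure_tilted (integrable_limitDensity γ)

lemma abs_integral_le_of_abs_le {α : Type*} [MeasurableSpace α] (μ : Measure α)
    [IsProbabilityMeasure μ] {f : α → ℝ} {a : ℝ} (hf : ∀ x, |f x| ≤ a) : |∫ x, f x ∂μ| ≤ a := by
  have := norm_integral_le_of_norm_le_const (μ := μ) (f := f) (Eventually.of_forall hf)
  simpa using this

lemma integrable_limitDensity_mul {γ : ℝ} {k : ℝ → ℝ} (hk : Continuous k) {K : ℝ}
    (hK : ∀ x, |k x| ≤ K) : Integrable fun x => limitDensity γ x * k x :=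
  (integrable_limitDensity γ).mul_bdd (c := K) hk.aestronglyMeasurable
    (Eventually.of_forall hK)

/-- This centring allows a primitive vanishing at both ends, so that the Stein solution satisfies
both boundary conditions of `exists_stein_bound`. -/
lemma integral_limitDensity_mul_sub {γ a : ℝ} {h : ℝ → ℝ} (hc : Continuous h)
    (ha : ∀ x, |h x| ≤ a) :
    ∫ x, limitDensity γ x * (h x - ∫ y, h y ∂limitLaw γ) = 0 := by
  have hZ : 0 < ∫ x, limitDensity γ x := integral_exp_pos (integrable_limitDensity γ)
  have hm : ∫ y, h y ∂limitLaw γ = (∫ x, limitDensity γ x * h x) / ∫ x, limitDensity γ x := by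
    unfold limitLaw
    rw [integral_tilted, ← integral_div]
    refine integral_congr_ae (Eventually.of_forall fun x => ?_)
    simp only [smul_eq_mul, limitDensity]
    ring
  simp_rw [mul_sub]
  rw [integral_sub (integrable_limitDensity_mul hc ha) ((integrable_limitDensity γ).mul_const _),
    integral_mul_const, hm]
  field_simp
  ring

/-- A primitive of a centred integrable continuous function which vanishes at both ends. -/
lemma exists_primitive_tendsto_zero {f : ℝ → ℝ} (hc : Continuous f) (hi : Integrable f)
    (h0 : ∫ x, f x = 0) : ∃ U : ℝ → ℝ, (∀ x, HasDerivAt U (f x) x) ∧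
      Tendsto U atTop (nhds 0) ∧ Tendsto U atBot (nhds 0) := by
  refine ⟨fun x => (∫ y in Set.Iic 0, f y) + ∫ y in (0 : ℝ)..x, f y, fun x => ?_, ?_, ?_⟩
  · exact (intervalIntegral.integral_hasDerivAt_right (hc.intervalIntegrable _ _)
      (hc.stronglyMeasurableAtFilter _ _) hc.continuousAt).const_add _
  · have := (intervalIntegral_tendsto_integral_Ioi (0 : ℝ) hi.integrableOn tendsto_id).const_add
      (∫ y in Set.Iic 0, f y)
    rwa [intervalIntegral.integral_Iic_add_Ioi hi.integrableOn hi.integrableOn, h0] at this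
  · have := (intervalIntegral_tendsto_integral_Iic (0 : ℝ) hi.integrableOn tendsto_id).const_sub
      (∫ y in Set.Iic 0, f y)
    rw [sub_self] at this
    refine this.congr fun x => ?_
    rw [intervalIntegral.integral_symm, sub_neg_eq_add]
    rfl

lemma abs_le_one_add_cube (w : ℝ) : |w| ≤ 1 + |w| ^ 3 := by
  have := abs_nonneg w
  nlinarith [sq_nonneg (|w| - 1), mul_nonneg this (sq_nonneg (|w| - 1))]

lemma abs_drift_le (γ x : ℝ) : |drift γ x| ≤ (1 + |γ|) * (1 + |x| ^ 3) := by
  have h1 := abs_le_one_add_cube x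
  unfold drift
  refine (abs_add_le _ _).trans ?_
  rw [abs_div, abs_pow, abs_mul, abs_of_pos (by norm_num : (0 : ℝ) < 3)]
  have := mul_le_mul_of_nonneg_left h1 (abs_nonneg γ)
  have : 0 ≤ |x| ^ 3 := by positivity
  linarith

lemma abs_sq_add_le (γ x : ℝ) : |x ^ 2 + γ| ≤ (1 + |γ|) * (1 + |x| ^ 3) := by
  have h0 := abs_nonneg x
  have h1 : |x| ^ 2 ≤ 1 + |x| ^ 3 := by
    nlinarith [mul_nonneg h0 (sq_nonneg (|x| - 1)), sq_nonneg (|x| - 1)]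
  refine (abs_add_le _ _).trans ?_
  rw [abs_pow]
  have : 0 ≤ |γ| * |x| ^ 3 := by positivity
  linarith

/-- Solution of the Stein equation `g' - drift γ * g = h - ∫ h` for the limit law,
with bounds on the solution and its first two derivatives. -/
lemma exists_stein_solution (γ : ℝ) : ∃ A : ℝ, 0 < A ∧ ∀ (a b : ℝ) (h : ℝ → ℝ), ContDiff ℝ 1 h →
    (∀ x, |h x| ≤ a) → (∀ x, |deriv h x| ≤ b) → ∃ g p q : ℝ → ℝ,
      (∀ x, HasDerivAt g (p x) x) ∧ (∀ x, HasDerivAt p (q x) x) ∧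
      (∀ x, p x = drift γ x * g x + (h x - ∫ y, h y ∂limitLaw γ)) ∧
      (∀ x, |g x| * (1 + |x| ^ 3) ≤ A * (a + b)) ∧ (∀ x, |p x| ≤ A * (a + b)) ∧
      ∀ x, |q x| ≤ A * (a + b) := by
  obtain ⟨C, hC, hbound⟩ := exists_stein_bound γ
  set D := 1 + |γ| with hD
  have hD0 : 0 < D := by positivity
  refine ⟨(D * C + 1) * (2 * D * C + 1) + 2 * D * C + 2 + 2 * C, by positivity,
    fun a b h hh ha hb => ?_⟩
  have ha0 : 0 ≤ a := (abs_nonneg _).trans (ha 0)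
  have hb0 : 0 ≤ b := (abs_nonneg _).trans (hb 0)
  set m := ∫ y, h y ∂limitLaw γ with hm
  have hma : |m| ≤ a := abs_integral_le_of_abs_le _ ha
  have hk : ∀ x, |h x - m| ≤ 2 * a := fun x => (abs_sub _ _).trans (by linarith [ha x])
  have hkc : Continuous fun x => h x - m := hh.continuous.sub continuous_const
  obtain ⟨U, hU, hUtop, hUbot⟩ := exists_primitive_tendsto_zero
    (f := fun x => limitDensity γ x * (h x - m)) ((continuous_limitDensity γ).mul hkc)
    (integrable_limitDensity_mul hkc hk)
    (integral_limitDensity_mul_sub hh.continuous ha)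
  set g : ℝ → ℝ := fun x => U x / limitDensity γ x with hg
  have hne : ∀ x, limitDensity γ x ≠ 0 := fun x => (limitDensity_pos γ x).ne'
  have hgU : ∀ x, limitDensity γ x * g x = U x := fun x => mul_div_cancel₀ _ (hne x)
  set p : ℝ → ℝ := fun x => drift γ x * g x + (h x - m) with hp
  have hgp : ∀ x, HasDerivAt g (p x) x := fun x => by
    refine ((hU x).fun_div (hasDerivAt_limitDensity γ x) (hne x)).congr_deriv ?_
    have := hne x
    simp only [hp, hg]
    field_simp
    ring
  have hgb := hbound (2 * a) g (fun x => h x - m) hgp hk (hUtop.congr fun x => (hgU x).symm)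
    (hUbot.congr fun x => (hgU x).symm)
  have hmul : ∀ (c K x y : ℝ), |c| ≤ D * (1 + |x| ^ 3) → |y| * (1 + |x| ^ 3) ≤ K →
      |c * y| ≤ D * K := fun c K x y h1 h2 => by
    rw [abs_mul]
    calc |c| * |y| ≤ D * (1 + |x| ^ 3) * |y| := by gcongr
      _ = D * (|y| * (1 + |x| ^ 3)) := by ring
      _ ≤ D * K := by gcongr
  have hpb : ∀ x, |p x| ≤ D * (C * (2 * a)) + 2 * a := fun x =>
    (abs_add_le _ _).trans (add_le_add (hmul _ _ x _ (abs_drift_le γ x) (hgb x)) (hk x))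
  -- Differentiating the Stein equation shows that `p` solves the same equation with right-hand side
  -- `k₂`, bounded because `g` decays cubically. A second use of `hbound` gives cubic decay of `p`,
  -- so `q = drift γ * p + k₂` is bounded too.
  set k₂ : ℝ → ℝ := fun x => (x ^ 2 + γ) * g x + deriv h x with hk₂
  have hk₂b : ∀ x, |k₂ x| ≤ D * (C * (2 * a)) + b := fun x =>
    (abs_add_le _ _).trans (add_le_add (hmul _ _ x _ (abs_sq_add_le γ x) (hgb x)) (hb x))
  have hpq : ∀ x, HasDerivAt p (drift γ x * p x + k₂ x) x := fun x => by
    have hd : HasDerivAt h (deriv h x) x := (hh.differentiable one_ne_zero x).hasDerivAt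
    refine (((hasDerivAt_drift γ x).fun_mul (hgp x)).fun_add (hd.sub_const m)).congr_deriv ?_
    simp only [hk₂]; ring
  have hbdd : ∀ l : Filter ℝ, Tendsto (limitDensity γ) l (nhds 0) →
      Tendsto (fun x => limitDensity γ x * p x) l (nhds 0) := fun l hl => by
    refine squeeze_zero_norm (a := fun x => limitDensity γ x * (D * (C * (2 * a)) + 2 * a))
      (fun x => ?_) (by simpa using hl.mul_const _)
    rw [norm_mul, Real.norm_of_nonneg (limitDensity_pos γ x).le]
    exact mul_le_mul_of_nonneg_left (hpb x) (limitDensity_pos γ x).le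
  have hpb' := hbound _ p k₂ hpq hk₂b (hbdd _ (tendsto_limitDensity_atTop γ))
    (hbdd _ (tendsto_limitDensity_atBot γ))
  have hDC : 0 ≤ D * C := by positivity
  have hDCa : 0 ≤ D * C * a := by positivity
  have hDCb : 0 ≤ D * C * b := by positivity
  have hDCDCa : 0 ≤ D * C * (D * C) * a := by positivity
  have hDCDCb : 0 ≤ D * C * (D * C) * b := by positivity
  have hCa : 0 ≤ C * a := by positivity
  have hCb : 0 ≤ C * b := by positivity
  refine ⟨g, p, fun x => drift γ x * p x + k₂ x, hgp, hpq, fun x => rfl,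
    fun x => (hgb x).trans ?_, fun x => (hpb x).trans ?_, fun x => ?_⟩
  · nlinarith
  · nlinarith
  · refine ((abs_add_le _ _).trans (add_le_add
      (hmul _ _ x _ (abs_drift_le γ x) (hpb' x)) (hk₂b x))).trans ?_
    nlinarith

/-! ### Expansion of the spin identity -/

lemma sum_sq_spin {n : ℕ} {x : Fin n → ℝ} (hx : ∀ i, x i = 1 ∨ x i = -1) :
    ∑ i, x i ^ 2 = n := by
  have : ∀ i, x i ^ 2 = 1 := fun i => by rcases hx i with h | h <;> rw [h] <;> norm_num
  simp [this]

/-- Since `1 - β = γ ε ^ 2` and `n ε ^ 4 = 1`, the linear and cubic Taylor terms of `tanh` give `γ w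
+ β ^ 3 w ^ 3 / 3`. The error comes from replacing `β ^ 3` by `1` and from the fifth order
remainder. -/
lemma abs_drift_error_le {n : ℕ} {ε γ β : ℝ} (hn : n * ε ^ 4 = 1) (hε : 0 < ε)
    (hβ : β = 1 - γ * ε ^ 2) (hβ2 : |β| ≤ 2) (w : ℝ) :
    |ε * n * (ε * w - Real.tanh (β * ε * w)) - drift γ w| ≤
      ε ^ 2 * (3 * |γ| * |w| ^ 3 + 32 * |w| ^ 5) := by
  set e := Real.tanh (β * ε * w) - (β * ε * w - (β * ε * w) ^ 3 / 3) with he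
  have h1 : ε * n * (ε * w - Real.tanh (β * ε * w)) - drift γ w =
      (β ^ 3 - 1) / 3 * w ^ 3 - ε * n * e := by
    rw [he]; unfold drift
    have : β * ε ^ 2 * n = ε ^ 2 * n - γ := by rw [hβ]; linear_combination (-γ) * hn
    linear_combination (β ^ 3 * w ^ 3 / 3) * hn - w * this
  have h2 : |(β ^ 3 - 1) / 3 * w ^ 3| ≤ ε ^ 2 * (3 * |γ| * |w| ^ 3) := by
    have h3 : (β ^ 3 - 1) / 3 * w ^ 3 = ε ^ 2 * (-γ * ((β ^ 2 + β + 1) / 3) * w ^ 3) := by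
      have : β - 1 = -γ * ε ^ 2 := by rw [hβ]; ring
      linear_combination ((β ^ 2 + β + 1) / 3 * w ^ 3) * this
    have h4 : |(β ^ 2 + β + 1) / 3| ≤ 3 := by
      rw [abs_le] at hβ2 ⊢
      constructor <;> nlinarith
    rw [h3, abs_mul, abs_mul, abs_mul, abs_neg, abs_pow, abs_pow, abs_of_pos hε, mul_comm 3]
    gcongr
  have h5 : |ε * n * e| ≤ ε ^ 2 * (32 * |w| ^ 5) := by
    have h6 : |e| ≤ |β| ^ 5 * ε ^ 5 * |w| ^ 5 := by
      refine (abs_tanh_sub_le _).trans_eq ?_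
      rw [abs_mul, abs_mul, abs_of_pos hε]; ring
    have h7 : |β| ^ 5 ≤ 32 := by
      refine (pow_le_pow_left₀ (abs_nonneg _) hβ2 5).trans ?_
      norm_num
    rw [abs_mul, abs_of_nonneg (by positivity : 0 ≤ ε * n)]
    calc ε * n * |e| ≤ ε * n * (32 * ε ^ 5 * |w| ^ 5) := by
          refine mul_le_mul_of_nonneg_left (h6.trans ?_) (by positivity)
          gcongr
      _ = n * ε ^ 4 * (ε ^ 2 * (32 * |w| ^ 5)) := by ring
      _ = _ := by rw [hn, one_mul]
  rw [h1]
  refine (abs_sub _ _).trans ?_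
  linarith

/-- Taylor expansion of the spin identity of `integral_spin_sub_tanh`, for a test function
satisfying the bounds of `exists_stein_solution`. -/
lemma abs_spin_expansion_le {n : ℕ} {ε γ β B : ℝ} (hn : n * ε ^ 4 = 1) (hε : 0 < ε) (hε1 : ε ≤ 1)
    (hβ : β = 1 - γ * ε ^ 2) (hβ2 : |β| ≤ 2) {g p q : ℝ → ℝ} (hg : ∀ x, HasDerivAt g (p x) x)
    (hp : ∀ x, HasDerivAt p (q x) x) (hgB : ∀ x, |g x| * (1 + |x| ^ 3) ≤ B)
    (hpB : ∀ x, |p x| ≤ B) (hqB : ∀ x, |q x| ≤ B) {x : Fin n → ℝ}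
    (hx : ∀ i, x i = 1 ∨ x i = -1) {W : ℝ} (hW : W = ε ^ 3 * magnetisation x) :
    |ε * ∑ i, (x i - Real.tanh (β / n * (magnetisation x - x i))) *
        g (ε ^ 3 * (magnetisation x - x i)) - (drift γ W * g W - p W)| ≤
      (3 * |γ| + 48) * B * ε ^ 2 * (1 + W ^ 2) := by
  have hn0 : (n : ℝ) ≠ 0 := by rintro h; simp [h] at hn
  have hB : 0 ≤ B := (abs_nonneg _).trans (hpB 0)
  have hg' : ∀ y, |g y| ≤ B := fun y =>
    (le_mul_of_one_le_right (abs_nonneg _) (by simp)).trans (hgB y)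
  have hg3 : |W| ^ 3 * |g W| ≤ B := by
    have := hgB W; have := abs_nonneg (g W); linarith
  have hg1 : |W| * |g W| ≤ B := by
    have := mul_le_mul_of_nonneg_right (abs_le_one_add_cube W) (abs_nonneg (g W))
    linarith [hgB W]
  set c := β * ε with hc
  have hc2 : |c| ≤ 2 := by
    rw [hc, abs_mul, abs_of_pos hε]; nlinarith [abs_nonneg β]
  set T : ℝ → ℝ := fun w => Real.tanh (c * w) with hT
  have hTd : ∀ w, HasDerivAt T (c * (1 - T w ^ 2)) w := fun w => by
    have := (hasDerivAt_tanh (c * w)).comp w ((hasDerivAt_id w).const_mul c)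
    exact this.congr_deriv (by simp only [hT]; ring)
  have hT1 : ∀ w, |T w| ≤ 1 := fun w => abs_tanh_le_one _
  have hT2 : ∀ w, |1 - T w ^ 2| ≤ 1 := fun w => by
    have h1 := tanh_sq_le_one (c * w)
    have h2 := sq_nonneg (T w)
    rw [abs_le]; constructor <;> simp only [hT] at * <;> linarith
  set u' : ℝ → ℝ := fun w => c * (1 - T w ^ 2) * g w + T w * p w with hu'
  set u'' : ℝ → ℝ := fun w => -2 * c * c * T w * (1 - T w ^ 2) * g w +
    2 * c * (1 - T w ^ 2) * p w + T w * q w with hu''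
  have hu : ∀ w, HasDerivAt (fun y => T y * g y) (u' w) w := fun w => (hTd w).fun_mul (hg w)
  have hud : ∀ w, HasDerivAt u' (u'' w) w := fun w => by
    have h1 := (((((hTd w).fun_pow 2).const_sub 1).const_mul c).fun_mul (hg w)).fun_add
      ((hTd w).fun_mul (hp w))
    refine h1.congr_deriv ?_
    simp only [hu'']; norm_num; ring
  have huB : ∀ w, |u'' w| ≤ 13 * B := fun w => by
    have h1 : |-2 * c * c * T w * (1 - T w ^ 2) * g w| ≤ 2 * 2 * 2 * 1 * 1 * B := by
      simp only [abs_mul, abs_neg, abs_two]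
      gcongr
      exacts [hT1 w, hT2 w, hg' w]
    have h2 : |2 * c * (1 - T w ^ 2) * p w| ≤ 2 * 2 * 1 * B := by
      simp only [abs_mul, abs_two]
      gcongr
      exacts [hT2 w, hpB w]
    have h3 : |T w * q w| ≤ 1 * B := by
      rw [abs_mul]
      gcongr
      exacts [hT1 w, hqB w]
    refine (abs_add_three _ _ _).trans ?_
    linarith
  set s : Fin n → ℝ := fun i => -(ε ^ 3 * x i) with hs
  set Rg : Fin n → ℝ := fun i => g (W + s i) - g W - s i * p W with hRg
  set Ru : Fin n → ℝ := fun i => T (W + s i) * g (W + s i) - T W * g W - s i * u' W with hRu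
  have hs2 : ∀ i, s i ^ 2 = ε ^ 6 := fun i => by
    rcases hx i with h | h <;> simp only [hs, h] <;> ring
  have hRgB : ∀ i, |Rg i| ≤ B * ε ^ 6 := fun i => hs2 i ▸ abs_taylor_le hg hp hqB W (s i)
  have hRuB : ∀ i, |Ru i| ≤ 13 * B * ε ^ 6 := fun i => hs2 i ▸ abs_taylor_le hu hud huB W (s i)
  have hterm : ∀ i, (x i - Real.tanh (β / n * (magnetisation x - x i))) *
      g (ε ^ 3 * (magnetisation x - x i)) = x i * (g W + ε ^ 3 * u' W) - x i ^ 2 * (ε ^ 3 * p W) -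
        T W * g W + (x i * Rg i - Ru i) := fun i => by
    have e1 : ε ^ 3 * (magnetisation x - x i) = W + s i := by rw [hW, hs]; ring
    have e2 : β / n * (magnetisation x - x i) = c * (W + s i) := by
      rw [← e1, hc, div_mul_eq_mul_div, div_eq_iff hn0]
      linear_combination (-β * (magnetisation x - x i)) * hn
    rw [e1, e2]
    simp only [hRg, hRu, hT, hs]
    ring
  have hsum : ∑ i, (x i - Real.tanh (β / n * (magnetisation x - x i))) *
      g (ε ^ 3 * (magnetisation x - x i)) = magnetisation x * (g W + ε ^ 3 * u' W) -
        n * (ε ^ 3 * p W) - n * (T W * g W) + ∑ i, (x i * Rg i - Ru i) := by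
    rw [Finset.sum_congr rfl fun i _ => hterm i]
    rw [Finset.sum_add_distrib, Finset.sum_sub_distrib, Finset.sum_sub_distrib, ← Finset.sum_mul,
      ← Finset.sum_mul, sum_sq_spin hx]
    simp [magnetisation]
  -- There are `n = ε ^ (-4)` remainders of order `ε ^ 6`, so this is even `O(ε ^ 3)`.
  have hrest : |ε * ∑ i, (x i * Rg i - Ru i)| ≤ 14 * B * ε ^ 2 := by
    have h1 : |∑ i, (x i * Rg i - Ru i)| ≤ n * (14 * B * ε ^ 6) := by
      refine (Finset.abs_sum_le_sum_abs _ _).trans ?_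
      refine (Finset.sum_le_card_nsmul _ _ (14 * B * ε ^ 6) fun i _ => ?_).trans_eq (by simp)
      have hxi : |x i| = 1 := by rcases hx i with h | h <;> simp [h]
      refine (abs_sub _ _).trans ?_
      rw [abs_mul, hxi, one_mul]
      linarith [hRgB i, hRuB i]
    rw [abs_mul, abs_of_pos hε]
    calc ε * |∑ i, (x i * Rg i - Ru i)| ≤ ε * (n * (14 * B * ε ^ 6)) := by gcongr
      _ = (n * ε ^ 4) * (14 * B * ε ^ 2) * ε := by ring
      _ ≤ (n * ε ^ 4) * (14 * B * ε ^ 2) * 1 := by gcongr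
      _ = _ := by rw [hn]; ring
  -- Both terms of `u'` carry a factor `ε`: one from the slope `c = β ε`, the other from `|T W| ≤ 2
  -- ε |W|`.
  have hmid : |ε * W * u' W| ≤ 2 * B * ε ^ 2 * (1 + W ^ 2) := by
    have hTW : |T W| ≤ 2 * ε * |W| := by
      refine (abs_tanh_le _).trans ?_
      rw [abs_mul, hc, abs_mul, abs_of_pos hε]
      gcongr
    have h1 : |u' W| ≤ 2 * ε * 1 * |g W| + 2 * ε * |W| * B := by
      refine (abs_add_le _ _).trans (add_le_add ?_ ?_)
      · rw [abs_mul, abs_mul, hc, abs_mul, abs_of_pos hε]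
        gcongr
        exact hT2 W
      · rw [abs_mul]
        gcongr
        exact hpB W
    rw [abs_mul, abs_mul, abs_of_pos hε]
    calc ε * |W| * |u' W| ≤ ε * |W| * (2 * ε * 1 * |g W| + 2 * ε * |W| * B) := by gcongr
      _ = 2 * ε ^ 2 * (|W| * |g W| + |W| ^ 2 * B) := by ring
      _ ≤ 2 * ε ^ 2 * (B + |W| ^ 2 * B) := by gcongr
      _ = _ := by rw [sq_abs]; ring
  -- The cubic decay of `g` absorbs `|W| ^ 3`, leaving only `W ^ 2`; a second moment is then enough.
  have hmain : |(ε * n * (ε * W - T W) - drift γ W) * g W| ≤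
      (3 * |γ| + 32) * B * ε ^ 2 * (1 + W ^ 2) := by
    rw [abs_mul]
    calc _ ≤ ε ^ 2 * (3 * |γ| * |W| ^ 3 + 32 * |W| ^ 5) * |g W| :=
          mul_le_mul_of_nonneg_right (abs_drift_error_le hn hε hβ hβ2 W) (abs_nonneg _)
      _ = ε ^ 2 * ((3 * |γ| + 32 * |W| ^ 2) * (|W| ^ 3 * |g W|)) := by ring
      _ ≤ ε ^ 2 * ((3 * |γ| + 32 * |W| ^ 2) * B) := by gcongr
      _ ≤ ε ^ 2 * (((3 * |γ| + 32) * (1 + W ^ 2)) * B) := by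
          rw [sq_abs]
          gcongr
          have : 0 ≤ |γ| * W ^ 2 := by positivity
          linarith
      _ = _ := by ring
  have hsplit : ε * (magnetisation x * (g W + ε ^ 3 * u' W) -
        n * (ε ^ 3 * p W) - n * (T W * g W) + ∑ i, (x i * Rg i - Ru i)) -
        (drift γ W * g W - p W) =
      (ε * n * (ε * W - T W) - drift γ W) * g W + ε * W * u' W +
        ε * ∑ i, (x i * Rg i - Ru i) := by
    rw [hW]
    linear_combination
      (-(p (ε ^ 3 * magnetisation x)) - ε * magnetisation x * g (ε ^ 3 * magnetisation x)) * hn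
  rw [hsum, hsplit]
  refine (abs_add_three _ _ _).trans ?_
  have : 0 ≤ B * ε ^ 2 * W ^ 2 := by positivity
  linarith

/-! ### The second moment of the magnetisation -/

/-- The right-hand side has mean zero under `spinLaw`, so integrating bounds the second moment.
Termwise, `mul_tanh_le` supplies a positive quartic term, which Cauchy–Schwarz turns into a multiple
of `W ^ 4`; this dominates the quadratic term whatever the sign of `γ`. -/
lemma sq_sub_le_spin_sum {n : ℕ} {ε γ β : ℝ} (hn : n * ε ^ 4 = 1) (hε : 0 < ε) (hn8 : 8 ≤ n)
    (hβ : β = 1 - γ * ε ^ 2) (hβ1 : 1 / 2 ≤ β) (hβ2 : β ≤ 11 / 10) {x : Fin n → ℝ}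
    (hx : ∀ i, x i = 1 ∨ x i = -1) :
    (ε ^ 3 * magnetisation x) ^ 2 - (3 + 64 * (γ - 1) ^ 2) ≤
      ε ^ 4 * ∑ i, (x i - Real.tanh (β / n * (magnetisation x - x i))) *
        (magnetisation x - x i) := by
  have hn8' : (8 : ℝ) ≤ n := by exact_mod_cast hn8
  have hn0 : (0 : ℝ) < n := by linarith
  set M := magnetisation x with hM
  have hxi : ∀ i, |x i| = 1 := fun i => by rcases hx i with h | h <;> simp [h]
  have hMn : |M| ≤ n := by
    refine (Finset.abs_sum_le_sum_abs _ _).trans ?_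
    simp [hxi]
  set a := β / n with ha
  have ha0 : 0 < a := by positivity
  have han : a * n = β := div_mul_cancel₀ _ hn0.ne'
  have hterm : ∀ i, x i * M - x i ^ 2 - a * (M - x i) ^ 2 + a ^ 3 / 8 * ((M - x i) ^ 2) ^ 2 ≤
      (x i - Real.tanh (a * (M - x i))) * (M - x i) := fun i => by
    have h1 : |a * (M - x i)| ≤ 5 / 4 := by
      rw [abs_mul, abs_of_pos ha0]
      -- `8 ≤ n` and `β ≤ 11/10` give `β (n + 1) / n ≤ 99/80`, within the range of `mul_tanh_le`.
      have h2 : |M - x i| ≤ n + 1 := (abs_sub _ _).trans (by rw [hxi i]; linarith)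
      calc a * |M - x i| ≤ a * (n + 1) := by gcongr
        _ ≤ a * (n * (9 / 8)) := by gcongr; linarith
        _ ≤ 5 / 4 := by rw [← mul_assoc, han]; linarith
    have h3 := mul_tanh_le h1
    have h4 : (M - x i) * Real.tanh (a * (M - x i)) ≤
        a * (M - x i) ^ 2 - a ^ 3 / 8 * ((M - x i) ^ 2) ^ 2 := by
      refine le_of_mul_le_mul_left ?_ ha0
      linarith
    linarith
  have hsq := sum_sq_spin hx
  have hsum1 : ∑ i, (M - x i) ^ 2 = (n - 2) * M ^ 2 + n := by
    have : ∀ i, (M - x i) ^ 2 = M ^ 2 - 2 * M * x i + x i ^ 2 := fun i => by ring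
    simp_rw [this]
    rw [Finset.sum_add_distrib, Finset.sum_sub_distrib, ← Finset.mul_sum, hsq]
    have : ∑ i, x i = M := rfl
    rw [this]
    simp; ring
  have hcs : ((n - 2) * M ^ 2 + n) ^ 2 ≤ n * ∑ i, ((M - x i) ^ 2) ^ 2 := by
    rw [← hsum1]
    simpa using sq_sum_le_card_mul_sum_sq (s := Finset.univ) (f := fun i => (M - x i) ^ 2)
  have hlow : M ^ 2 - n - a * ((n - 2) * M ^ 2 + n) +
      a ^ 3 / 8 * ∑ i, ((M - x i) ^ 2) ^ 2 ≤
      ∑ i, (x i - Real.tanh (a * (M - x i))) * (M - x i) := by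
    refine le_trans (le_of_eq ?_) (Finset.sum_le_sum fun i _ => hterm i)
    rw [Finset.sum_add_distrib, Finset.sum_sub_distrib, Finset.sum_sub_distrib, ← Finset.mul_sum,
      ← Finset.mul_sum, ← Finset.sum_mul, hsq, hsum1]
    have : ∑ i, x i = M := rfl
    rw [this]; ring
  have hquart : n * M ^ 4 / 4 ≤ ∑ i, ((M - x i) ^ 2) ^ 2 := by
    have h1 : (n / 2 * M ^ 2) ^ 2 ≤ ((n - 2) * M ^ 2 + n) ^ 2 := by
      refine pow_le_pow_left₀ (by positivity) ?_ 2
      have := mul_nonneg (by linarith : 0 ≤ (n : ℝ) / 2 - 2) (sq_nonneg M)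
      linarith
    refine le_of_mul_le_mul_left ?_ hn0
    linarith
  have hlow2 : M ^ 2 - n - β * M ^ 2 - β + a ^ 3 * n * M ^ 4 / 32 ≤
      ∑ i, (x i - Real.tanh (a * (M - x i))) * (M - x i) := by
    refine le_trans ?_ hlow
    have h1 := mul_le_mul_of_nonneg_left hquart (by positivity : 0 ≤ a ^ 3 / 8)
    have h2 : 0 ≤ a * M ^ 2 := by positivity
    have h3 : a * ((n - 2) * M ^ 2 + n) = β * M ^ 2 - 2 * (a * M ^ 2) + β := by
      rw [← han]; ring
    rw [h3]
    linarith
  refine le_trans ?_ (mul_le_mul_of_nonneg_left hlow2 (by positivity : 0 ≤ ε ^ 4))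
  set W := ε ^ 3 * M with hW
  have haε : a = β * ε ^ 4 := by
    rw [ha, div_eq_iff hn0.ne']; linear_combination (-β) * hn
  have e : ε ^ 4 * (M ^ 2 - n - β * M ^ 2 - β + a ^ 3 * n * M ^ 4 / 32) =
      γ * W ^ 2 - 1 - β * ε ^ 4 + β ^ 3 * W ^ 4 / 32 := by
    have h1 : 1 - β = γ * ε ^ 2 := by rw [hβ]; ring
    rw [haε, hW]
    linear_combination (ε ^ 4 * M ^ 2) * h1 + (β ^ 3 * ε ^ 12 * M ^ 4 / 32 - 1) * hn
  rw [e]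
  have hε4 : ε ^ 4 ≤ 1 := by nlinarith [pow_pos hε 4]
  have h1 : β * ε ^ 4 ≤ 2 := by nlinarith [pow_pos hε 4]
  have h2 : 1 / 8 * W ^ 4 ≤ β ^ 3 * W ^ 4 := by
    have := pow_le_pow_left₀ (by norm_num) hβ1 3
    norm_num at this
    gcongr
  -- Completes the square in `W ^ 4 / 256 + (γ - 1) W ^ 2 + 64 (γ - 1) ^ 2`.
  nlinarith [sq_nonneg (W ^ 2 + 128 * (γ - 1))]

lemma integral_sq_magnetisation_le {n : ℕ} {ε γ β : ℝ} (hn : n * ε ^ 4 = 1) (hε : 0 < ε)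
    (hn8 : 8 ≤ n) (hβ : β = 1 - γ * ε ^ 2) (hβ1 : 1 / 2 ≤ β) (hβ2 : β ≤ 11 / 10) :
    ∫ x, (ε ^ 3 * magnetisation x) ^ 2 ∂spinLaw n β ≤ 3 + 64 * (γ - 1) ^ 2 := by
  have hMc := continuous_magnetisation n
  have hTc := continuous_tanh
  have h0 : ∫ x, ε ^ 4 * ∑ i, (x i - Real.tanh (β / n * (magnetisation x - x i))) *
      (magnetisation x - x i) ∂spinLaw n β = 0 := by
    rw [integral_const_mul, integral_finsetSum _ fun i _ => integrable_spinLaw β (by fun_prop)]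
    simp [fun i : Fin n => integral_spin_sub_tanh β i continuous_id']
  have h1 : ∫ x, ((ε ^ 3 * magnetisation x) ^ 2 - (3 + 64 * (γ - 1) ^ 2)) ∂spinLaw n β ≤ 0 := by
    rw [← h0]
    refine integral_mono_ae (integrable_spinLaw β (by fun_prop))
      (integrable_spinLaw β (by fun_prop)) ?_
    filter_upwards [ae_spinLaw n β] with x hx
    exact sq_sub_le_spin_sum hn hε hn8 hβ hβ1 hβ2 hx
  rw [integral_sub (integrable_spinLaw β (by fun_prop)) (integrable_const _)] at h1
  simp at h1
  linarith

/-- Error bound in terms of `ε = n ^ (-1 / 4)`, for `n` large. -/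
lemma exists_abs_integral_sub_le (γ : ℝ) : ∃ C : ℝ, 0 < C ∧ ∀ (n : ℕ) (ε β a b : ℝ) (h : ℝ → ℝ),
    n * ε ^ 4 = 1 → 0 < ε → ε ≤ 1 → 8 ≤ n → β = 1 - γ * ε ^ 2 → 1 / 2 ≤ β → β ≤ 11 / 10 →
    ContDiff ℝ 1 h → (∀ x, |h x| ≤ a) → (∀ x, |deriv h x| ≤ b) →
    |(∫ x, h (ε ^ 3 * magnetisation x) ∂spinLaw n β) - ∫ x, h x ∂limitLaw γ| ≤
      C * ε ^ 2 * (a + b) := by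
  obtain ⟨A, hA, hstein⟩ := exists_stein_solution γ
  refine ⟨(3 * |γ| + 48) * A * (1 + (3 + 64 * (γ - 1) ^ 2)), by positivity, ?_⟩
  intro n ε β a b h hn hε hε1 hn8 hβ hβ1 hβ2 hh ha hb
  obtain ⟨g, p, q, hg, hp, hpg, hgB, hpB, hqB⟩ := hstein a b h hh ha hb
  set m := ∫ x, h x ∂limitLaw γ
  have ha0 : 0 ≤ a := (abs_nonneg _).trans (ha 0)
  have hb0 : 0 ≤ b := (abs_nonneg _).trans (hb 0)
  have hMc := continuous_magnetisation n
  have hTc := continuous_tanh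
  have hgc : Continuous g := continuous_iff_continuousAt.2 fun x => (hg x).continuousAt
  have hhc := hh.continuous
  have hf : Continuous fun y => g (ε ^ 3 * y) := by fun_prop
  set S : (Fin n → ℝ) → ℝ := fun x => ε * ∑ i, (x i - Real.tanh (β / n * (magnetisation x - x i))) *
    g (ε ^ 3 * (magnetisation x - x i)) with hS
  have hSi : Integrable S (spinLaw n β) := integrable_spinLaw β (by fun_prop)
  have hS0 : ∫ x, S x ∂spinLaw n β = 0 := by
    rw [integral_const_mul, integral_finsetSum _ fun i _ => integrable_spinLaw β (by fun_prop)]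
    simp [fun i : Fin n => integral_spin_sub_tanh β i hf]
  have hhi : Integrable (fun x => h (ε ^ 3 * magnetisation x)) (spinLaw n β) :=
    integrable_spinLaw β (by fun_prop)
  have hdiff : (∫ x, h (ε ^ 3 * magnetisation x) ∂spinLaw n β) - m =
      ∫ x, (S x + (h (ε ^ 3 * magnetisation x) - m)) ∂spinLaw n β := by
    rw [integral_add hSi (integrable_spinLaw β (by fun_prop)), hS0,
      integral_sub hhi (integrable_const _)]
    simp
  rw [hdiff, ← Real.norm_eq_abs]
  refine (norm_integral_le_of_norm_le (g := fun x => (3 * |γ| + 48) * (A * (a + b)) * ε ^ 2 *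
    (1 + (ε ^ 3 * magnetisation x) ^ 2)) (integrable_spinLaw β (by fun_prop)) ?_).trans ?_
  · filter_upwards [ae_spinLaw n β] with x hx
    have hβabs : |β| ≤ 2 := by rw [abs_le]; constructor <;> linarith
    have := abs_spin_expansion_le hn hε hε1 hβ hβabs hg hp hgB hpB hqB hx rfl
    rw [hpg] at this
    rw [Real.norm_eq_abs]
    convert this using 2
    simp only [hS]; ring
  · rw [integral_const_mul, integral_add (integrable_const _)
      (integrable_spinLaw β (by fun_prop))]
    have h1 := integral_sq_magnetisation_le hn hε hn8 hβ hβ1 hβ2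
    simp only [integral_const, probReal_univ, smul_eq_mul, mul_one]
    calc _ ≤ (3 * |γ| + 48) * (A * (a + b)) * ε ^ 2 * (1 + (3 + 64 * (γ - 1) ^ 2)) := by gcongr
      _ = _ := by ring

end CurieWeiss

theorem theorem3p3 (γ : ℝ) (hγ : γ ≠ 0) :
    ∃ (C : ℝ) (r : ℕ → ℝ), 0 < C ∧
      r =O[atTop] (fun n : ℕ => (1 : ℝ) / (n : ℝ) ^ (3 / 4 : ℝ)) ∧
      ∀ n : ℕ, 1 ≤ n → ∀ h : ℝ → ℝ, ContDiff ℝ 1 h →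
        BddAbove (Set.range fun x => |h x|) → BddAbove (Set.range fun x => |deriv h x|) →
        |(∫ x, h (CurieWeiss.magnetisation x / (n : ℝ) ^ (3 / 4 : ℝ))
              ∂(CurieWeiss.spinLaw n (1 - γ / √(n : ℝ)))) -
            ∫ x, h x ∂(CurieWeiss.limitLaw γ)| ≤
          (C / √(n : ℝ) + r n) * (CurieWeiss.supNorm h + CurieWeiss.supNorm (deriv h)) := by
  obtain ⟨C, hC, hbound⟩ := CurieWeiss.exists_abs_integral_sub_le γ
  -- No correction `r` is needed. The extra summand makes the constant over `√n` at least `2`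
  -- whenever `√n ≤ 8 + 10 |γ|`, which covers every `n` outside the large range.
  refine ⟨C + 2 * (8 + 10 * |γ|), fun _ => 0, by positivity, isBigO_zero _ _, ?_⟩
  intro n hn1 h hh hb hb'
  have ha : ∀ x, |h x| ≤ CurieWeiss.supNorm h := fun x => le_ciSup hb x
  have hb : ∀ x, |deriv h x| ≤ CurieWeiss.supNorm (deriv h) := fun x => le_ciSup hb' x
  have ha0 := (abs_nonneg _).trans (ha 0)
  have hb0 := (abs_nonneg _).trans (hb 0)
  set a := CurieWeiss.supNorm h
  set b := CurieWeiss.supNorm (deriv h)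
  have hn1' : (1 : ℝ) ≤ n := by exact_mod_cast hn1
  have hn0 : (0 : ℝ) < n := by linarith
  have hs0 : 0 < √(n : ℝ) := Real.sqrt_pos.2 hn0
  rw [add_zero]
  -- The second condition forces `|γ| / √n ≤ 1/10`, keeping `β` in `[9/10, 11/10]`.
  by_cases hlarge : 8 ≤ n ∧ 10 * |γ| ≤ √(n : ℝ)
  · obtain ⟨hn8, hγn⟩ := hlarge
    set ε : ℝ := ((n : ℝ) ^ (1 / 4 : ℝ))⁻¹ with hε
    have hε0 : 0 < ε := by positivity
    have hε1 : ε ≤ 1 := inv_le_one_of_one_le₀ (Real.one_le_rpow hn1' (by norm_num))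
    have hε4 : n * ε ^ 4 = 1 := by
      rw [hε, inv_pow, ← Real.rpow_natCast, ← Real.rpow_mul hn0.le]
      norm_num
      exact mul_inv_cancel₀ hn0.ne'
    have hε2 : ε ^ 2 = (√(n : ℝ))⁻¹ := by
      rw [hε, inv_pow, ← Real.rpow_natCast, ← Real.rpow_mul hn0.le, Real.sqrt_eq_rpow]
      norm_num
    have hε3 : ε ^ 3 = ((n : ℝ) ^ (3 / 4 : ℝ))⁻¹ := by
      rw [hε, inv_pow, ← Real.rpow_natCast, ← Real.rpow_mul hn0.le]
      norm_num
    have hβ : 1 - γ / √(n : ℝ) = 1 - γ * ε ^ 2 := by rw [hε2]; rfl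
    have hsmall : |γ / √(n : ℝ)| ≤ 1 / 10 := by
      rw [abs_div, abs_of_pos hs0, div_le_iff₀ hs0]; linarith
    rw [abs_le] at hsmall
    have key := hbound n ε (1 - γ / √(n : ℝ)) a b h hε4 hε0 hε1 hn8 hβ (by linarith)
      (by linarith) hh ha hb
    have e : ∀ y : ℝ, y / (n : ℝ) ^ (3 / 4 : ℝ) = ε ^ 3 * y := fun y => by
      rw [hε3]; ring
    simp_rw [e]
    refine key.trans ?_
    rw [hε2, ← div_eq_mul_inv]
    gcongr
    have := abs_nonneg γ
    linarith
  · have hsn : √(n : ℝ) ≤ 8 + 10 * |γ| := by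
      rcases not_and_or.1 hlarge with h8 | h8
      · have h9 : (n : ℝ) ≤ 8 := by exact_mod_cast (not_le.1 h8).le
        have h10 : √(n : ℝ) ≤ n := by
          rw [Real.sqrt_le_left hn0.le]; nlinarith
        have := abs_nonneg γ
        linarith
      · linarith
    have h1 := CurieWeiss.abs_integral_le_of_abs_le (CurieWeiss.spinLaw n (1 - γ / √(n : ℝ)))
      (fun x => ha (CurieWeiss.magnetisation x / (n : ℝ) ^ (3 / 4 : ℝ)))
    have h2 := CurieWeiss.abs_integral_le_of_abs_le (CurieWeiss.limitLaw γ) ha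
    have h3 : 2 ≤ (C + 2 * (8 + 10 * |γ|)) / √(n : ℝ) := by
      rw [le_div_iff₀ hs0]; linarith
    calc _ ≤ a + a := (abs_sub _ _).trans (add_le_add h1 h2)
      _ ≤ 2 * (a + b) := by linarith
      _ ≤ _ := by gcongr
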